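/- Let $m,n\ge 1$ and let $m_s\in\mathbb{R}^{m\times n}$ be fixed. For $X\in\mathbb{R}^{m\times n}$ write $\|X\|_1=\sum_{i,j}|X_{ij}|$, let $\|X\|_*$ be the nuclear norm (the sum of the singular values of $X$), and let $\|X\|_{op}$ be the operator norm with respect to the Euclidean norms (the largest singular value). Consider the problem $$\min_{m_c\in\mathbb{R}^{m\times n}} \|m_c\|_1\quad\text{subject to}\quad \operatorname{rank}(m_c)>\operatorname{rank}(m_s),\tag{P}$$ the problem obtained from it by replacing the rank by the nuclear norm, $$\min_{m_c\in\mathbb{R}^{m\times n}} \|m_c\|_1\quad\text{subject to}\quad \|m_c\|_*>\|m_s\|_*,\tag{R}$$ and, for $\lambda\ge 0$, the penalty function $$\mathcal L(m_c,m_s,\lambda)=\|m_c\|_1+\lambda\max(0,\|m_s\|_*-\|m_c\|_*).$$ Since the constraint of (R) is strict, its minimum is understood as the infimum $v$ of $\|\cdot\|_1$ over its feasible set, and a solution of (R) is a matrix in the closure of the feasible set whose $\ell_1$-norm equals $v$. Then: 1. (P) is non-convex because of the rank constraint: the objective $\|\cdot\|_1$ is convex, but $\operatorname{rank}$ is not a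 convex function on $\mathbb{R}^{m\times n}$, and the feasible set of (P), if non-empty, is not convex. 2. The nuclear norm is the convex envelope of the rank on the ball $B=\{X:\|X\|_{op}\le 1\}$: it is convex on $B$, satisfies $\|X\|_*\le\operatorname{rank}(X)$ for $X\in B$, and every convex $h:B\to\mathbb{R}$ with $h\le\operatorname{rank}$ on $B$ satisfies $h(X)\le\|X\|_*$ for all $X\in B$. 3. The penalty formulation enforces the constraint of (R), up to its boundary, as $\lambda\to\infty$: (a) if $\|m_c\|_*\ge\|m_s\|_*$, then $\mathcal L(m_c,m_s,\lambda)=\|m_c\|_1$ for all $\lambda$; if $\|m_c\|_*<\|m_s\|_*$, then $\mathcal L(m_c,m_s,\lambda)\to\infty$ as $\lambda\to\infty$; (b) for every $\lambda\ge 0$ the function $\mathcal L(\cdot,m_s,\lambda)$ has a minimiser over $\mathbb{R}^{m\times n}$; the feasible set of (R) is non-empty, its infimum $v$ is finite, and (R) has a solution; (c) if $\lambda_k\to\infty$ and, for each $k$, $X_k$ is a minimiser of $\mathcal L(\cdot,m_s,\lambda_k)$, then $\|X_k\|_*\ge\|m_s\|_*$ for all sufficiently large $k$, $\mathcal L(X_k,m_s,\lambda_k)\to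 v$, $\|X_k\|_1\to v$, and $X_k$ converges to the set of solutions of (R) (every open set containing all solutions of (R) contains $X_k$ for all sufficiently large $k$). -/

import Mathlib

open Filter Topology

noncomputable section

namespace MergerRelaxation

variable {m n : ℕ}

/-- The entrywise `ℓ¹` norm of a real matrix. -/
def l1Norm (X : Matrix (Fin m) (Fin n) ℝ) : ℝ :=
  ∑ i, ∑ j, |X i j|

/-- The rank, as a real-valued function. -/
def rankFn (X : Matrix (Fin m) (Fin n) ℝ) : ℝ :=
  (X.rank : ℝ)

/-- The nuclear norm: the sum of the singular values of the matrix, seen as a linear map between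
Euclidean spaces. (Singular values with index at least `n` vanish.) -/
def nuclearNorm (X : Matrix (Fin m) (Fin n) ℝ) : ℝ :=
  ∑ i ∈ Finset.range n, (Matrix.toEuclideanLin X).singularValues i

/-- The closed unit ball of the (Euclidean) operator norm. -/
def opUnitBall (m n : ℕ) : Set (Matrix (Fin m) (Fin n) ℝ) :=
  {X | ‖(Matrix.toEuclideanLin X).toContinuousLinearMap‖ ≤ 1}

/-- `g` is the convex envelope of `f` on `s`: the largest convex function on `s` below `f`. -/
def IsConvexEnvelopeOn {E : Type*} [AddCommGroup E] [Module ℝ E]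
    (s : Set E) (f g : E → ℝ) : Prop :=
  ConvexOn ℝ s g ∧ (∀ x ∈ s, g x ≤ f x) ∧
    ∀ h : E → ℝ, ConvexOn ℝ s h → (∀ x ∈ s, h x ≤ f x) → ∀ x ∈ s, h x ≤ g x

/-- The feasible set of the constraint `f X > f S`. It is used with `f` the rank (the original
problem) and with `f` the nuclear norm (the relaxed problem). -/
def feasible (f : Matrix (Fin m) (Fin n) ℝ → ℝ) (S : Matrix (Fin m) (Fin n) ℝ) :
    Set (Matrix (Fin m) (Fin n) ℝ) :=
  {X | f S < f X}

/-- The solutions of `min ‖X‖₁` subject to `‖X‖_* > ‖S‖_*`. As the constraint is strict, these are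
the limits of feasible matrices at which the infimum of the objective over the feasible set is
taken. -/
def relaxedSolutions (S : Matrix (Fin m) (Fin n) ℝ) : Set (Matrix (Fin m) (Fin n) ℝ) :=
  {X | X ∈ closure (feasible nuclearNorm S) ∧
    IsGLB (l1Norm '' feasible nuclearNorm S) (l1Norm X)}

/-- The penalty function `‖X‖₁ + t * max (0, ‖S‖_* - ‖X‖_*)`. -/
def penalty (X S : Matrix (Fin m) (Fin n) ℝ) (t : ℝ) : ℝ :=
  l1Norm X + t * max 0 (nuclearNorm S - nuclearNorm X)

/-- `X` minimises the penalty function with parameter `t` over all matrices. -/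
def IsPenaltyMinimizer (S : Matrix (Fin m) (Fin n) ℝ) (t : ℝ)
    (X : Matrix (Fin m) (Fin n) ℝ) : Prop :=
  ∀ Y, penalty X S t ≤ penalty Y S t

end MergerRelaxation

end

/-!
The singular value decomposition gives the duality `‖T‖_* = max {|tr (W* T)| : ‖W‖ ≤ 1}`, which
makes the trace norm a seminorm.

For the convex envelope, fix the singular vectors of a contraction `T` and replace its singular
values by `s`. The resulting map depends linearly on `s`, is a contraction for `s` in the cube
`[0, 1]^d`, and at a vertex of the cube has rank at most `∑ i, s i`. A convex `h ≤ rank` is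
therefore at most `∑ i, s i` at the vertices, and so on the cube, in particular at the singular
values of `T`, where this sum is `‖T‖_*`.

The penalty is exact. As `‖X‖₁ ≤ m n ‖X‖_*`, an infeasible `X` can be scaled up to the boundary of
the constraint (or, if `X = 0`, replaced by `S`) at a cost of at most `m n` times the gap
`‖S‖_* - ‖X‖_*`. Hence for `t > m n` every minimiser of the penalty function already solves the
relaxed problem, whose strict constraint has the non-strict one as its closure.
-/

namespace MergerRelaxation

open Module (finrank)
open scoped InnerProductSpace

theorem norm_sum_sq_of_pairwise_inner_eq_zero {𝕜 E ι : Type*} [RCLike 𝕜]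
    [SeminormedAddCommGroup E] [InnerProductSpace 𝕜 E] [Fintype ι] {v : ι → E}
    (hv : Pairwise fun i j => ⟪v i, v j⟫_𝕜 = 0) : ‖∑ i, v i‖ ^ 2 = ∑ i, ‖v i‖ ^ 2 := by
  have h : ((‖∑ i, v i‖ ^ 2 : ℝ) : 𝕜) = ((∑ i, ‖v i‖ ^ 2 : ℝ) : 𝕜) := by
    push_cast
    simp_rw [← inner_self_eq_norm_sq_to_K, sum_inner, inner_sum]
    exact Finset.sum_congr rfl fun i _ => Fintype.sum_eq_single i fun j hji => hv hji.symm
  exact_mod_cast h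

section SingularVectors

variable {𝕜 E F : Type*} [RCLike 𝕜]
  [NormedAddCommGroup E] [InnerProductSpace 𝕜 E] [FiniteDimensional 𝕜 E]
  [NormedAddCommGroup F] [InnerProductSpace 𝕜 F] [FiniteDimensional 𝕜 F]

/-- The right singular vectors of `T`: an orthonormal eigenbasis of `T.adjoint ∘ₗ T`, in the order
of `T.singularValues`. -/
noncomputable def rightSingularBasis (T : E →ₗ[𝕜] F) : OrthonormalBasis (Fin (finrank 𝕜 E)) 𝕜 E :=
  T.isSymmetric_adjoint_comp_self.eigenvectorBasis rfl

/-- The left singular vectors of `T`. Those that belong to the singular value zero are set to zero,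
so that no orthonormal basis of `F` has to be matched with `rightSingularBasis T`. -/
noncomputable def leftSingularVector (T : E →ₗ[𝕜] F) (i : Fin (finrank 𝕜 E)) : F :=
  (T.singularValues i : 𝕜)⁻¹ • T (rightSingularBasis T i)

theorem inner_apply_rightSingularBasis (T : E →ₗ[𝕜] F) (i j : Fin (finrank 𝕜 E)) :
    ⟪T (rightSingularBasis T i), T (rightSingularBasis T j)⟫_𝕜 =
      if i = j then (T.singularValues i : 𝕜) ^ 2 else 0 := by
  have heigen : T.adjoint (T (rightSingularBasis T j)) =
      (T.singularValues j : 𝕜) ^ 2 • rightSingularBasis T j := by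
    rw [← RCLike.ofReal_pow, T.sq_singularValues_fin rfl]
    exact T.isSymmetric_adjoint_comp_self.apply_eigenvectorBasis rfl j
  rw [← LinearMap.adjoint_inner_right, heigen, inner_smul_right,
    (rightSingularBasis T).inner_eq_ite]
  split_ifs with hij <;> simp [hij]

theorem norm_apply_rightSingularBasis (T : E →ₗ[𝕜] F) (i : Fin (finrank 𝕜 E)) :
    ‖T (rightSingularBasis T i)‖ = T.singularValues i := by
  have h := inner_apply_rightSingularBasis T i i
  rw [if_pos rfl, inner_self_eq_norm_sq_to_K] at h
  exact (sq_eq_sq₀ (norm_nonneg _) (T.singularValues_nonneg i)).mp (by exact_mod_cast h)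

theorem apply_rightSingularBasis (T : E →ₗ[𝕜] F) (i : Fin (finrank 𝕜 E)) :
    T (rightSingularBasis T i) = (T.singularValues i : 𝕜) • leftSingularVector T i := by
  rcases eq_or_ne (T.singularValues i) 0 with h | h
  · rw [h, RCLike.ofReal_zero, zero_smul, ← norm_eq_zero, norm_apply_rightSingularBasis, h]
  · rw [leftSingularVector, smul_inv_smul₀ (RCLike.ofReal_ne_zero.mpr h)]

theorem inner_leftSingularVector_of_ne (T : E →ₗ[𝕜] F) {i j : Fin (finrank 𝕜 E)} (hij : i ≠ j) :
    ⟪leftSingularVector T i, leftSingularVector T j⟫_𝕜 = 0 := by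
  simp [leftSingularVector, inner_smul_left, inner_smul_right, inner_apply_rightSingularBasis, hij]

theorem norm_leftSingularVector_le_one (T : E →ₗ[𝕜] F) (i : Fin (finrank 𝕜 E)) :
    ‖leftSingularVector T i‖ ≤ 1 := by
  rw [leftSingularVector, norm_smul, norm_inv, RCLike.norm_ofReal, norm_apply_rightSingularBasis,
    abs_of_nonneg (T.singularValues_nonneg i)]
  exact inv_mul_le_one

theorem inner_leftSingularVector_apply_rightSingularBasis (T : E →ₗ[𝕜] F)
    (i : Fin (finrank 𝕜 E)) :
    ⟪leftSingularVector T i, T (rightSingularBasis T i)⟫_𝕜 = T.singularValues i := by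
  rw [leftSingularVector, inner_smul_left, inner_apply_rightSingularBasis, if_pos rfl, map_inv₀,
    RCLike.conj_ofReal, sq, mul_comm, mul_self_mul_inv]

/-- The linear map with matrix `diag s` with respect to the right and left singular vectors of `T`:
the singular values in the singular value decomposition of `T` are replaced by `s`. -/
noncomputable def singularDiagonal (T : E →ₗ[𝕜] F) : (Fin (finrank 𝕜 E) → 𝕜) →ₗ[𝕜] E →ₗ[𝕜] F :=
  ((rightSingularBasis T).toBasis.constr 𝕜).toLinearMap ∘ₗ
    LinearMap.pi fun i => (LinearMap.proj i).smulRight (leftSingularVector T i)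

theorem singularDiagonal_rightSingularBasis (T : E →ₗ[𝕜] F) (s : Fin (finrank 𝕜 E) → 𝕜)
    (i : Fin (finrank 𝕜 E)) :
    singularDiagonal T s (rightSingularBasis T i) = s i • leftSingularVector T i := by
  rw [← OrthonormalBasis.coe_toBasis]
  exact Module.Basis.constr_basis _ 𝕜 _ i

theorem singularDiagonal_singularValues (T : E →ₗ[𝕜] F) :
    singularDiagonal T (fun i => (T.singularValues i : 𝕜)) = T := by
  refine (rightSingularBasis T).toBasis.ext fun i => ?_
  rw [OrthonormalBasis.coe_toBasis, singularDiagonal_rightSingularBasis, apply_rightSingularBasis]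

theorem norm_singularDiagonal_apply_le (T : E →ₗ[𝕜] F) {s : Fin (finrank 𝕜 E) → 𝕜} {C : ℝ}
    (hC : 0 ≤ C) (hs : ∀ i, ‖s i‖ ≤ C) (x : E) : ‖singularDiagonal T s x‖ ≤ C * ‖x‖ := by
  set b := rightSingularBasis T
  have hsum : singularDiagonal T s x =
      ∑ i, ⟪b i, x⟫_𝕜 • s i • leftSingularVector T i := by
    conv_lhs => rw [← b.sum_repr' x]
    simp only [map_sum, map_smul, b, singularDiagonal_rightSingularBasis]
  have horth : Pairwise fun i j => ⟪⟪b i, x⟫_𝕜 • s i • leftSingularVector T i,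
      ⟪b j, x⟫_𝕜 • s j • leftSingularVector T j⟫_𝕜 = 0 := fun i j hij => by
    simp [inner_smul_left, inner_smul_right, inner_leftSingularVector_of_ne T hij]
  refine (sq_le_sq₀ (norm_nonneg _) (by positivity)).mp ?_
  calc ‖singularDiagonal T s x‖ ^ 2
      = ∑ i, (‖⟪b i, x⟫_𝕜‖ * (‖s i‖ * ‖leftSingularVector T i‖)) ^ 2 := by
        simp only [hsum, norm_sum_sq_of_pairwise_inner_eq_zero horth, norm_smul]
    _ ≤ ∑ i, (‖⟪b i, x⟫_𝕜‖ * (C * 1)) ^ 2 := by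
        gcongr with i
        exacts [hs i, norm_leftSingularVector_le_one T i]
    _ = (C * ‖x‖) ^ 2 := by
        simp only [mul_one, mul_pow, ← Finset.sum_mul, b.sum_sq_norm_inner_right]
        ring

theorem finrank_range_singularDiagonal_le [DecidableEq 𝕜] (T : E →ₗ[𝕜] F)
    (s : Fin (finrank 𝕜 E) → 𝕜) :
    finrank 𝕜 (singularDiagonal T s).range ≤ Finset.card {i | s i ≠ 0} := by
  classical
  have hle : (singularDiagonal T s).range ≤
      Submodule.span 𝕜 (Finset.image (leftSingularVector T) {i | s i ≠ 0}) := by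
    rw [LinearMap.range_eq_map, ← (rightSingularBasis T).toBasis.span_eq, Submodule.map_span_le]
    rintro _ ⟨i, rfl⟩
    rw [OrthonormalBasis.coe_toBasis, singularDiagonal_rightSingularBasis]
    rcases eq_or_ne (s i) 0 with hi | hi
    · simp [hi]
    · exact Submodule.smul_mem _ _
        (Submodule.subset_span (Finset.mem_image_of_mem _ (by simpa using hi)))
  exact (Submodule.finrank_mono hle).trans
    ((finrank_span_finset_le_card _).trans Finset.card_image_le)

end SingularVectors

section TraceNorm

variable {𝕜 E F : Type*} [RCLike 𝕜]
  [NormedAddCommGroup E] [InnerProductSpace 𝕜 E]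
  [NormedAddCommGroup F] [InnerProductSpace 𝕜 F]

variable (𝕜 E F) in
/-- The linear maps of operator norm at most one, as plain linear maps. -/
def contractions : Set (E →ₗ[𝕜] F) :=
  {T | ∀ x, ‖T x‖ ≤ ‖x‖}

theorem convex_contractions [NormedSpace ℝ F] [IsScalarTower ℝ 𝕜 F] :
    Convex ℝ (contractions 𝕜 E F) := by
  intro S hS T hT a b ha hb hab x
  have hball := convex_closedBall (0 : F) ‖x‖ (mem_closedBall_zero_iff.mpr (hS x))
    (mem_closedBall_zero_iff.mpr (hT x)) ha hb hab
  exact mem_closedBall_zero_iff.mp hball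

variable [FiniteDimensional 𝕜 E] [FiniteDimensional 𝕜 F]

theorem singularDiagonal_mem_contractions (T : E →ₗ[𝕜] F) {s : Fin (finrank 𝕜 E) → 𝕜}
    (hs : ∀ i, ‖s i‖ ≤ 1) : singularDiagonal T s ∈ contractions 𝕜 E F := fun x =>
  (norm_singularDiagonal_apply_le T zero_le_one hs x).trans_eq (one_mul _)

theorem singularValues_le_one {T : E →ₗ[𝕜] F} (hT : T ∈ contractions 𝕜 E F)
    (i : Fin (finrank 𝕜 E)) : T.singularValues i ≤ 1 := by
  rw [← norm_apply_rightSingularBasis, ← (rightSingularBasis T).norm_eq_one i]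
  exact hT _

/-- The trace norm of `T`: the sum of its singular values. It extends the nuclear norm of real
matrices to linear maps between finite-dimensional inner product spaces. -/
noncomputable def traceNorm (T : E →ₗ[𝕜] F) : ℝ :=
  ∑ i : Fin (finrank 𝕜 E), T.singularValues i

theorem norm_trace_adjoint_comp_le_traceNorm (T : E →ₗ[𝕜] F) {W : E →ₗ[𝕜] F}
    (hW : W ∈ contractions 𝕜 E F) :
    ‖LinearMap.trace 𝕜 E (W.adjoint ∘ₗ T)‖ ≤ traceNorm T := by
  rw [LinearMap.trace_eq_sum_inner _ (rightSingularBasis T)]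
  refine norm_sum_le_of_le _ fun i _ => ?_
  calc ‖⟪rightSingularBasis T i, (W.adjoint ∘ₗ T) (rightSingularBasis T i)⟫_𝕜‖
      ≤ ‖W (rightSingularBasis T i)‖ * ‖T (rightSingularBasis T i)‖ := by
        rw [LinearMap.comp_apply, LinearMap.adjoint_inner_right]
        exact norm_inner_le_norm _ _
    _ ≤ 1 * T.singularValues i := by
        rw [norm_apply_rightSingularBasis]
        gcongr
        · exact T.singularValues_nonneg i
        · exact (hW _).trans_eq ((rightSingularBasis T).norm_eq_one i)
    _ = T.singularValues i := one_mul _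

theorem trace_adjoint_singularDiagonal_one_comp (T : E →ₗ[𝕜] F) :
    LinearMap.trace 𝕜 E ((singularDiagonal T 1).adjoint ∘ₗ T) = traceNorm T := by
  rw [LinearMap.trace_eq_sum_inner _ (rightSingularBasis T), traceNorm, RCLike.ofReal_sum]
  refine Finset.sum_congr rfl fun i _ => ?_
  rw [LinearMap.comp_apply, LinearMap.adjoint_inner_right, singularDiagonal_rightSingularBasis,
    Pi.one_apply, one_smul, inner_leftSingularVector_apply_rightSingularBasis]

theorem exists_norm_trace_adjoint_comp_eq_traceNorm (T : E →ₗ[𝕜] F) :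
    ∃ W ∈ contractions 𝕜 E F, ‖LinearMap.trace 𝕜 E (W.adjoint ∘ₗ T)‖ = traceNorm T := by
  refine ⟨_, singularDiagonal_mem_contractions T (s := 1) fun i => norm_one.le, ?_⟩
  rw [trace_adjoint_singularDiagonal_one_comp, RCLike.norm_ofReal, abs_of_nonneg]
  exact Finset.sum_nonneg fun i _ => T.singularValues_nonneg i

variable (𝕜 E F) in
/-- The trace norm as a seminorm. -/
noncomputable def traceSeminorm : Seminorm 𝕜 (E →ₗ[𝕜] F) :=
  .ofSMulLE traceNorm (by simp [traceNorm])
    (fun S T => by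
      obtain ⟨W, hW, h⟩ := exists_norm_trace_adjoint_comp_eq_traceNorm (S + T)
      rw [← h, LinearMap.comp_add, map_add]
      exact norm_add_le_of_le (norm_trace_adjoint_comp_le_traceNorm S hW)
        (norm_trace_adjoint_comp_le_traceNorm T hW))
    (fun c T => by
      obtain ⟨W, hW, h⟩ := exists_norm_trace_adjoint_comp_eq_traceNorm (c • T)
      rw [← h, LinearMap.comp_smul, map_smul, norm_smul]
      gcongr
      exact norm_trace_adjoint_comp_le_traceNorm T hW)

theorem norm_apply_le_traceNorm_mul_norm (T : E →ₗ[𝕜] F) (x : E) :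
    ‖T x‖ ≤ traceNorm T * ‖x‖ := by
  conv_lhs => rw [← singularDiagonal_singularValues T]
  refine norm_singularDiagonal_apply_le T (apply_nonneg (traceSeminorm 𝕜 E F) T) (fun i => ?_) x
  rw [RCLike.norm_ofReal, abs_of_nonneg (T.singularValues_nonneg i)]
  exact Finset.single_le_sum (f := fun i : Fin (finrank 𝕜 E) => T.singularValues i)
    (fun i _ => T.singularValues_nonneg i) (Finset.mem_univ i)

theorem traceNorm_le_finrank_range {T : E →ₗ[𝕜] F} (hT : T ∈ contractions 𝕜 E F) :
    traceNorm T ≤ finrank 𝕜 T.range := by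
  have hle (i : Fin (finrank 𝕜 E)) :
      T.singularValues i ≤ if (i : ℕ) < finrank 𝕜 T.range then 1 else 0 := by
    split_ifs with hi
    · exact singularValues_le_one hT i
    · exact (T.singularValues_eq_zero_iff_le_finrank_range.mpr (not_lt.mp hi)).le
  calc traceNorm T
      ≤ ∑ i : Fin (finrank 𝕜 E), if (i : ℕ) < finrank 𝕜 T.range then (1 : ℝ) else 0 :=
        Finset.sum_le_sum fun i _ => hle i
    _ = finrank 𝕜 T.range := by
        rw [Finset.sum_boole, Fin.card_filter_val_lt,
          min_eq_right (LinearMap.finrank_range_le T)]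

end TraceNorm

section ConvexEnvelope

theorem convexHull_setOf_forall_eq_zero_or_eq_one {ι : Type*} [Finite ι] :
    convexHull ℝ {s : ι → ℝ | ∀ i, s i = 0 ∨ s i = 1} = Set.Icc 0 1 := by
  have hvertices : {s : ι → ℝ | ∀ i, s i = 0 ∨ s i = 1} = Set.univ.pi fun _ => {0, 1} := by
    ext s
    simp
  rw [hvertices, convexHull_pi, convexHull_pair, segment_eq_Icc zero_le_one]
  exact Set.pi_univ_Icc 0 1

theorem le_sum_of_convexOn_Icc {ι : Type*} [Fintype ι] {g : (ι → ℝ) → ℝ}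
    (hg : ConvexOn ℝ (Set.Icc 0 1) g)
    (hvertex : ∀ s : ι → ℝ, (∀ i, s i = 0 ∨ s i = 1) → g s ≤ ∑ i, s i) {s : ι → ℝ}
    (hs : s ∈ Set.Icc 0 1) : g s ≤ ∑ i, s i := by
  have hlin : ConcaveOn ℝ (Set.Icc 0 1) fun s : ι → ℝ => ∑ i, s i :=
    ⟨convex_Icc 0 1, fun s _ t _ a b _ _ _ => by simp [Finset.sum_add_distrib, Finset.mul_sum]⟩
  rw [← convexHull_setOf_forall_eq_zero_or_eq_one] at hg hlin hs
  obtain ⟨v, hv, hle⟩ := (hg.sub hlin).exists_ge_of_mem_convexHull (subset_convexHull ℝ _) hs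
  simp only [Pi.sub_apply] at hle
  linarith [hvertex v hv]

variable {𝕜 E F : Type*} [RCLike 𝕜]
  [NormedAddCommGroup E] [InnerProductSpace 𝕜 E] [FiniteDimensional 𝕜 E]
  [NormedAddCommGroup F] [InnerProductSpace 𝕜 F] [FiniteDimensional 𝕜 F]
  [NormedSpace ℝ F] [IsScalarTower ℝ 𝕜 F]

theorem le_traceNorm_of_convexOn_contractions {h : (E →ₗ[𝕜] F) → ℝ}
    (hconv : ConvexOn ℝ (contractions 𝕜 E F) h)
    (hrank : ∀ T ∈ contractions 𝕜 E F, h T ≤ finrank 𝕜 T.range)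
    {T : E →ₗ[𝕜] F} (hT : T ∈ contractions 𝕜 E F) : h T ≤ traceNorm T := by
  let D : (Fin (finrank 𝕜 E) → ℝ) →ₗ[ℝ] E →ₗ[𝕜] F :=
    (singularDiagonal T).restrictScalars ℝ ∘ₗ (RCLike.ofRealAm (K := 𝕜)).toLinearMap.compLeft _
  have hDT : D (fun i => T.singularValues i) = T := singularDiagonal_singularValues T
  have hDmem : Set.Icc 0 1 ⊆ D ⁻¹' contractions 𝕜 E F := fun s hs =>
    singularDiagonal_mem_contractions T fun i => by
      simpa [abs_of_nonneg (hs.1 i)] using hs.2 i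
  have hvertex (s : Fin (finrank 𝕜 E) → ℝ) (hs : ∀ i, s i = 0 ∨ s i = 1) :
      h (D s) ≤ ∑ i, s i := by
    classical
    have hmem : s ∈ Set.Icc 0 1 := by
      rw [← convexHull_setOf_forall_eq_zero_or_eq_one]
      exact subset_convexHull ℝ _ hs
    calc h (D s) ≤ finrank 𝕜 (D s).range := hrank _ (hDmem hmem)
      _ ≤ Finset.card {i | (s i : 𝕜) ≠ 0} :=
        Nat.cast_le.mpr (finrank_range_singularDiagonal_le T fun i => (s i : 𝕜))
      _ = ∑ i, s i := by
        rw [← Finset.sum_boole]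
        exact Finset.sum_congr rfl fun i _ => by rcases hs i with h | h <;> simp [h]
  have hle : h (D fun i => T.singularValues i) ≤ traceNorm T :=
    le_sum_of_convexOn_Icc ((hconv.comp_linearMap D).subset hDmem (convex_Icc 0 1)) hvertex
      ⟨fun i => T.singularValues_nonneg i, fun i => singularValues_le_one hT i⟩
  rwa [hDT] at hle

theorem isConvexEnvelopeOn_traceNorm :
    IsConvexEnvelopeOn (contractions 𝕜 E F) (fun T => (finrank 𝕜 T.range : ℝ)) traceNorm :=
  ⟨(traceSeminorm 𝕜 E F).convexOn.subset (Set.subset_univ _) convex_contractions,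
    fun _ hT => traceNorm_le_finrank_range hT,
    fun _ hconv hrank _ hT => le_traceNorm_of_convexOn_contractions hconv hrank hT⟩

theorem IsConvexEnvelopeOn.comp_linearEquiv {V W : Type*} [AddCommGroup V] [Module ℝ V]
    [AddCommGroup W] [Module ℝ W] {s : Set W} {f g : W → ℝ} (h : IsConvexEnvelopeOn s f g)
    (e : V ≃ₗ[ℝ] W) : IsConvexEnvelopeOn (e ⁻¹' s) (f ∘ e) (g ∘ e) := by
  obtain ⟨hconv, hle, hmax⟩ := h
  refine ⟨hconv.comp_linearMap e.toLinearMap, fun x hx => hle _ hx, fun k hk hkf x hx => ?_⟩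
  have hk' : ConvexOn ℝ s (k ∘ e.symm) := by
    have hpre : e.symm ⁻¹' (e ⁻¹' s) = s := by
      ext
      simp
    exact hpre ▸ hk.comp_linearMap e.symm.toLinearMap
  simpa using hmax _ hk' (fun y hy => by simpa using hkf (e.symm y) (by simpa using hy)) (e x) hx

end ConvexEnvelope

section NuclearNorm

variable {m n : ℕ}

theorem nuclearNorm_eq_traceNorm (X : Matrix (Fin m) (Fin n) ℝ) :
    nuclearNorm X = traceNorm (Matrix.toEuclideanLin X) := by
  rw [nuclearNorm, traceNorm,
    Fin.sum_univ_eq_sum_range (fun i => (Matrix.toEuclideanLin X).singularValues i),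
    finrank_euclideanSpace_fin]

theorem rankFn_eq_finrank_range (X : Matrix (Fin m) (Fin n) ℝ) :
    rankFn X = finrank ℝ (Matrix.toEuclideanLin X).range := by
  rw [rankFn, Matrix.toEuclideanLin, Matrix.toLpLin_eq_toLin]
  exact congrArg _ (X.rank_eq_finrank_range_toLin _ _)

theorem opUnitBall_eq_preimage_contractions :
    opUnitBall m n = Matrix.toEuclideanLin ⁻¹' contractions ℝ _ _ := by
  ext X
  simp [opUnitBall, contractions, ContinuousLinearMap.opNorm_le_iff]

theorem isConvexEnvelopeOn_nuclearNorm :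
    IsConvexEnvelopeOn (opUnitBall m n) rankFn nuclearNorm := by
  rw [opUnitBall_eq_preimage_contractions, funext rankFn_eq_finrank_range,
    funext nuclearNorm_eq_traceNorm]
  exact IsConvexEnvelopeOn.comp_linearEquiv (isConvexEnvelopeOn_traceNorm (𝕜 := ℝ)
    (E := EuclideanSpace ℝ (Fin n)) (F := EuclideanSpace ℝ (Fin m))) Matrix.toEuclideanLin

/-- The nuclear norm as a seminorm. -/
noncomputable def nuclearSeminorm : Seminorm ℝ (Matrix (Fin m) (Fin n) ℝ) :=
  (traceSeminorm ℝ _ _).comp Matrix.toEuclideanLin.toLinearMap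

theorem coe_nuclearSeminorm : ⇑(nuclearSeminorm (m := m) (n := n)) = nuclearNorm :=
  funext fun X => (nuclearNorm_eq_traceNorm X).symm

theorem abs_apply_le_nuclearNorm (X : Matrix (Fin m) (Fin n) ℝ) (i : Fin m) (j : Fin n) :
    |X i j| ≤ nuclearNorm X :=
  calc |X i j| = ‖Matrix.toEuclideanLin X (EuclideanSpace.single j 1) i‖ := by
        simp [Matrix.toLpLin_apply]
    _ ≤ ‖Matrix.toEuclideanLin X (EuclideanSpace.single j 1)‖ := PiLp.norm_apply_le _ i
    _ ≤ traceNorm (Matrix.toEuclideanLin X) * ‖EuclideanSpace.single j (1 : ℝ)‖ :=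
        norm_apply_le_traceNorm_mul_norm _ _
    _ = nuclearNorm X := by simp [nuclearNorm_eq_traceNorm]

theorem nuclearNorm_pos {X : Matrix (Fin m) (Fin n) ℝ} (hX : X ≠ 0) : 0 < nuclearNorm X := by
  obtain ⟨i, j, hij⟩ : ∃ i j, X i j ≠ 0 := by simpa [← Matrix.ext_iff] using hX
  exact (abs_pos.mpr hij).trans_le (abs_apply_le_nuclearNorm X i j)

attribute [local instance] Matrix.normedAddCommGroup Matrix.normedSpace in
theorem continuous_nuclearNorm : Continuous (nuclearNorm (m := m) (n := n)) :=
  coe_nuclearSeminorm (m := m) (n := n) ▸ nuclearSeminorm.convexOn.locallyLipschitz.continuous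

end NuclearNorm

section Rank

variable {m n : ℕ}

theorem rankFn_smul {c : ℝ} (hc : c ≠ 0) (X : Matrix (Fin m) (Fin n) ℝ) :
    rankFn (c • X) = rankFn X := by
  rw [rankFn, X.rank_smul_of_mem_nonZeroDivisors (mem_nonZeroDivisors_of_ne_zero hc), rankFn]

theorem rankFn_zero : rankFn (0 : Matrix (Fin m) (Fin n) ℝ) = 0 := by
  simp [rankFn]

theorem rankFn_pos {X : Matrix (Fin m) (Fin n) ℝ} (hX : X ≠ 0) : 0 < rankFn X := by
  rw [rankFn_eq_finrank_range, Nat.cast_pos, Nat.pos_iff_ne_zero, ne_eq,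
    Submodule.finrank_eq_zero, LinearMap.range_eq_bot, LinearEquiv.map_eq_zero_iff]
  exact hX

theorem not_convexOn_rankFn [Nontrivial (Matrix (Fin m) (Fin n) ℝ)] :
    ¬ ConvexOn ℝ Set.univ (rankFn (m := m) (n := n)) := by
  intro hconv
  obtain ⟨X, hX⟩ := exists_ne (0 : Matrix (Fin m) (Fin n) ℝ)
  have hhalf := hconv.2 (Set.mem_univ X) (Set.mem_univ 0) one_half_pos.le one_half_pos.le
    (add_halves (1 : ℝ))
  rw [smul_zero, add_zero, rankFn_smul one_half_pos.ne', rankFn_zero, smul_zero, add_zero,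
    smul_eq_mul] at hhalf
  linarith [rankFn_pos hX]

theorem not_convex_feasible_rankFn {S : Matrix (Fin m) (Fin n) ℝ}
    (hS : (feasible rankFn S).Nonempty) : ¬ Convex ℝ (feasible rankFn S) := by
  intro hconv
  obtain ⟨X, hX⟩ := hS
  have hnegX : (-1 : ℝ) • X ∈ feasible rankFn S := by
    rw [feasible, Set.mem_ofPred_eq, rankFn_smul (neg_ne_zero.mpr one_ne_zero)]
    exact hX
  have hzero : (0 : Matrix (Fin m) (Fin n) ℝ) ∈ feasible rankFn S := by
    simpa using hconv.midpoint_mem hX hnegX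
  rw [feasible, Set.mem_ofPred_eq, rankFn_zero] at hzero
  exact hzero.not_ge (Nat.cast_nonneg _)

end Rank

section SeminormConstraint

variable {E : Type*} [AddCommGroup E] [Module ℝ E]

theorem closure_setOf_lt_seminorm [TopologicalSpace E] [ContinuousAdd E] [ContinuousSMul ℝ E]
    {p : Seminorm ℝ E} (hp : Continuous p) {z : E} (hz : p z ≠ 0) (r : ℝ) :
    closure {x | r < p x} = {x | r ≤ p x} := by
  refine (closure_minimal (fun x hx => le_of_lt hx) (isClosed_le continuous_const hp)).antisymm
    fun x hx => ?_
  obtain ⟨d, hd⟩ : ∃ d, ∀ ε : ℝ, 0 < ε → p x < p (x + ε • d) := by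
    rcases (apply_nonneg p x).eq_or_lt with hx0 | hx0
    · refine ⟨z, fun ε hε => ?_⟩
      have hpos : 0 < p (ε • z) := by
        rw [map_smul_eq_mul]
        exact mul_pos (norm_pos_iff.mpr hε.ne') ((apply_nonneg p z).lt_of_ne' hz)
      have htri := map_sub_le_add p (x + ε • z) x
      rw [add_sub_cancel_left] at htri
      linarith
    · refine ⟨x, fun ε hε => ?_⟩
      have hscale : x + ε • x = (1 + ε) • x := by module
      rw [hscale, map_smul_eq_mul, Real.norm_of_nonneg (by positivity)]
      exact lt_mul_of_one_lt_left hx0 (lt_add_of_pos_right 1 hε)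
  have hlim : Tendsto (fun ε : ℝ => x + ε • d) (𝓝[>] 0) (𝓝 x) := by
    have hcont : Continuous fun ε : ℝ => x + ε • d := by fun_prop
    exact (hcont.tendsto' 0 x (by simp)).mono_left nhdsWithin_le_nhds
  refine mem_closure_of_tendsto hlim ?_
  filter_upwards [self_mem_nhdsWithin] with ε hε
  exact lt_of_le_of_lt hx (hd ε hε)

theorem exists_seminorm_eq_and_lt_add_mul_sub {p q : Seminorm ℝ E} {C t : ℝ}
    (hqp : ∀ x, q x ≤ C * p x) (ht : C < t) {x y : E} (hxy : p x < p y) :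
    ∃ z, p z = p y ∧ q z < q x + t * (p y - p x) := by
  have hgap : C * (p y - p x) < t * (p y - p x) := mul_lt_mul_of_pos_right ht (sub_pos.mpr hxy)
  rcases (apply_nonneg p x).eq_or_lt with hx | hx
  · refine ⟨y, rfl, ?_⟩
    rw [← hx, sub_zero] at hgap ⊢
    linarith [hqp y, apply_nonneg q x]
  · set c := p y / p x
    have hc : 1 < c := (one_lt_div hx).mpr hxy
    have hcx : c * p x = p y := div_mul_cancel₀ _ hx.ne'
    have hc_norm : ‖c‖ = c := Real.norm_of_nonneg (zero_le_one.trans hc.le)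
    refine ⟨c • x, by rw [map_smul_eq_mul, hc_norm, hcx], ?_⟩
    calc q (c • x) = q x + (c - 1) * q x := by
          rw [map_smul_eq_mul, hc_norm]
          ring
      _ ≤ q x + (c - 1) * (C * p x) := by
          gcongr
          exact hqp x
      _ = q x + C * (p y - p x) := by
          rw [← hcx]
          ring
      _ < q x + t * (p y - p x) := by gcongr

end SeminormConstraint

theorem isGLB_image_iff_isMinOn_closure {α β : Type*} [TopologicalSpace α] [TopologicalSpace β]
    [Preorder β] [OrderClosedTopology β] {f : α → β} (hf : Continuous f) {s : Set α} {x : α}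
    (hx : x ∈ closure s) : IsGLB (f '' s) (f x) ↔ IsMinOn f (closure s) x := by
  rw [isGLB_iff_of_subset_of_subset_closure (Set.image_mono subset_closure)
    (image_closure_subset_closure_image hf)]
  exact ⟨fun h y hy => h.1 (Set.mem_image_of_mem f hy), fun h =>
    IsLeast.isGLB ⟨Set.mem_image_of_mem f hx, Set.forall_mem_image.mpr h⟩⟩

section L1Norm

variable {m n : ℕ}

/-- The entrywise `ℓ¹` norm as a seminorm. -/
noncomputable def l1Seminorm : Seminorm ℝ (Matrix (Fin m) (Fin n) ℝ) :=
  .of l1Norm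
    (fun X Y => by
      simp only [l1Norm, ← Finset.sum_add_distrib]
      gcongr
      exact abs_add_le _ _)
    (fun c X => by simp [l1Norm, Finset.mul_sum, abs_mul])

theorem convexOn_l1Norm : ConvexOn ℝ Set.univ (l1Norm (m := m) (n := n)) :=
  l1Seminorm.convexOn

theorem continuous_l1Norm : Continuous (l1Norm (m := m) (n := n)) := by
  unfold l1Norm
  fun_prop

theorem abs_apply_le_l1Norm (X : Matrix (Fin m) (Fin n) ℝ) (i : Fin m) (j : Fin n) :
    |X i j| ≤ l1Norm X :=
  calc |X i j| ≤ ∑ j, |X i j| :=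
        Finset.single_le_sum (fun j _ => abs_nonneg (X i j)) (Finset.mem_univ j)
    _ ≤ l1Norm X :=
        Finset.single_le_sum (f := fun i => ∑ j, |X i j|) (fun _ _ => by positivity)
          (Finset.mem_univ i)

theorem l1Norm_le_mul_nuclearNorm (X : Matrix (Fin m) (Fin n) ℝ) :
    l1Norm X ≤ m * n * nuclearNorm X :=
  calc l1Norm X ≤ ∑ _i : Fin m, ∑ _j : Fin n, nuclearNorm X :=
        Finset.sum_le_sum fun i _ => Finset.sum_le_sum fun j _ => abs_apply_le_nuclearNorm X i j
    _ = m * n * nuclearNorm X := by simp [mul_assoc]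

attribute [local instance] Matrix.normedAddCommGroup in
theorem tendsto_l1Norm_cocompact_atTop :
    Tendsto (l1Norm (m := m) (n := n)) (cocompact _) atTop := by
  have : ProperSpace (Matrix (Fin m) (Fin n) ℝ) := pi_properSpace
  exact tendsto_atTop_mono
    (fun X => (Matrix.norm_le_iff (apply_nonneg l1Seminorm X)).mpr (abs_apply_le_l1Norm X))
    tendsto_norm_cocompact_atTop

theorem exists_isMinOn_of_l1Norm_le {f : Matrix (Fin m) (Fin n) ℝ → ℝ} (hf : Continuous f)
    (hle : ∀ X, l1Norm X ≤ f X) {C : Set (Matrix (Fin m) (Fin n) ℝ)} (hC : IsClosed C)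
    (hne : C.Nonempty) : ∃ X ∈ C, IsMinOn f C X := by
  obtain ⟨Z, hZ⟩ := hne
  have hcoercive := tendsto_atTop_mono hle tendsto_l1Norm_cocompact_atTop
  exact hf.continuousOn.exists_isMinOn' hC hZ
    ((hcoercive.eventually_ge_atTop (f Z)).filter_mono inf_le_left)

end L1Norm

section Penalty

variable {m n : ℕ}

theorem continuous_penalty (S : Matrix (Fin m) (Fin n) ℝ) (t : ℝ) :
    Continuous fun X => penalty X S t :=
  continuous_l1Norm.add (continuous_const.mul
    (continuous_const.max (continuous_const.sub continuous_nuclearNorm)))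

theorem l1Norm_le_penalty (X S : Matrix (Fin m) (Fin n) ℝ) {t : ℝ} (ht : 0 ≤ t) :
    l1Norm X ≤ penalty X S t :=
  le_add_of_nonneg_right (mul_nonneg ht (le_max_left _ _))

theorem penalty_eq_l1Norm {X S : Matrix (Fin m) (Fin n) ℝ} (h : nuclearNorm S ≤ nuclearNorm X)
    (t : ℝ) : penalty X S t = l1Norm X := by
  rw [penalty, max_eq_left (sub_nonpos.mpr h), mul_zero, add_zero]

theorem tendsto_penalty_atTop {X S : Matrix (Fin m) (Fin n) ℝ}
    (h : nuclearNorm X < nuclearNorm S) : Tendsto (fun t => penalty X S t) atTop atTop :=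
  tendsto_atTop_add_const_left _ _
    (tendsto_id.atTop_mul_const (lt_max_of_lt_right (sub_pos.mpr h)))

theorem exists_isPenaltyMinimizer (S : Matrix (Fin m) (Fin n) ℝ) {t : ℝ} (ht : 0 ≤ t) :
    ∃ X, IsPenaltyMinimizer S t X := by
  obtain ⟨X, -, hX⟩ := exists_isMinOn_of_l1Norm_le (continuous_penalty S t)
    (fun X => l1Norm_le_penalty X S ht) isClosed_univ Set.univ_nonempty
  exact ⟨X, isMinOn_univ_iff.mp hX⟩

theorem IsPenaltyMinimizer.nuclearNorm_le {S X : Matrix (Fin m) (Fin n) ℝ} {t : ℝ}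
    (hX : IsPenaltyMinimizer S t X) (ht : (m * n : ℝ) < t) : nuclearNorm S ≤ nuclearNorm X := by
  by_contra! hlt
  obtain ⟨Y, hYS, hYX⟩ : ∃ Y, nuclearNorm Y = nuclearNorm S ∧
      l1Norm Y < l1Norm X + t * (nuclearNorm S - nuclearNorm X) := by
    rw [← coe_nuclearSeminorm] at hlt ⊢
    exact exists_seminorm_eq_and_lt_add_mul_sub (q := l1Seminorm)
      (fun Z => coe_nuclearSeminorm (m := m) ▸ l1Norm_le_mul_nuclearNorm Z) ht hlt
  have hmin := hX Y
  rw [penalty_eq_l1Norm hYS.ge, penalty, max_eq_right (sub_nonneg.mpr hlt.le)] at hmin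
  exact hmin.not_gt hYX

section RelaxedProblem

variable [Nontrivial (Matrix (Fin m) (Fin n) ℝ)] {S : Matrix (Fin m) (Fin n) ℝ}

variable (S) in
theorem closure_feasible_nuclearNorm :
    closure (feasible nuclearNorm S) = {X | nuclearNorm S ≤ nuclearNorm X} := by
  obtain ⟨Z, hZ⟩ := exists_ne (0 : Matrix (Fin m) (Fin n) ℝ)
  have hcont := continuous_nuclearNorm (m := m) (n := n)
  have hZ' := (nuclearNorm_pos hZ).ne'
  rw [← coe_nuclearSeminorm] at hcont hZ' ⊢
  exact closure_setOf_lt_seminorm hcont hZ' _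

variable (S) in
theorem feasible_nuclearNorm_nonempty : (feasible nuclearNorm S).Nonempty := by
  rw [← closure_nonempty_iff, closure_feasible_nuclearNorm]
  exact ⟨S, le_refl (nuclearNorm S)⟩

theorem mem_relaxedSolutions_iff {X : Matrix (Fin m) (Fin n) ℝ} :
    X ∈ relaxedSolutions S ↔ nuclearNorm S ≤ nuclearNorm X ∧
      IsMinOn l1Norm {Y | nuclearNorm S ≤ nuclearNorm Y} X := by
  rw [relaxedSolutions, Set.mem_ofPred_eq,
    and_congr_right (isGLB_image_iff_isMinOn_closure continuous_l1Norm),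
    closure_feasible_nuclearNorm, Set.mem_ofPred_eq]

variable (S) in
theorem relaxedSolutions_nonempty : (relaxedSolutions S).Nonempty := by
  obtain ⟨X, hX, hmin⟩ := exists_isMinOn_of_l1Norm_le continuous_l1Norm (fun _ => le_rfl)
    (isClosed_le continuous_const continuous_nuclearNorm) ⟨S, le_refl (nuclearNorm S)⟩
  exact ⟨X, mem_relaxedSolutions_iff.mpr ⟨hX, hmin⟩⟩

theorem IsPenaltyMinimizer.mem_relaxedSolutions {X : Matrix (Fin m) (Fin n) ℝ} {t : ℝ}
    (hX : IsPenaltyMinimizer S t X) (ht : (m * n : ℝ) < t) : X ∈ relaxedSolutions S := by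
  have hfeas := hX.nuclearNorm_le ht
  refine mem_relaxedSolutions_iff.mpr ⟨hfeas, fun Y hY => ?_⟩
  rw [Set.mem_ofPred_eq, ← penalty_eq_l1Norm hfeas t, ← penalty_eq_l1Norm hY t]
  exact hX Y

end RelaxedProblem

end Penalty

end MergerRelaxation

theorem lemma1 (m n : ℕ) (hm : 0 < m) (hn : 0 < n) (S : Matrix (Fin m) (Fin n) ℝ) :
    -- the objective is convex; the rank and the rank constraint are not
    ConvexOn ℝ Set.univ (MergerRelaxation.l1Norm (m := m) (n := n)) ∧
    ¬ ConvexOn ℝ Set.univ (MergerRelaxation.rankFn (m := m) (n := n)) ∧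
    ((MergerRelaxation.feasible MergerRelaxation.rankFn S).Nonempty →
      ¬ Convex ℝ (MergerRelaxation.feasible MergerRelaxation.rankFn S)) ∧
    -- the nuclear norm is the convex envelope of the rank on the operator norm unit ball
    MergerRelaxation.IsConvexEnvelopeOn (MergerRelaxation.opUnitBall m n)
      MergerRelaxation.rankFn MergerRelaxation.nuclearNorm ∧
    -- the penalty vanishes where `‖X‖_* ≥ ‖S‖_*` and blows up elsewhere
    (∀ X : Matrix (Fin m) (Fin n) ℝ,
      MergerRelaxation.nuclearNorm S ≤ MergerRelaxation.nuclearNorm X →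
        ∀ t : ℝ, MergerRelaxation.penalty X S t = MergerRelaxation.l1Norm X) ∧
    (∀ X : Matrix (Fin m) (Fin n) ℝ,
      MergerRelaxation.nuclearNorm X < MergerRelaxation.nuclearNorm S →
        Tendsto (fun t : ℝ => MergerRelaxation.penalty X S t) atTop atTop) ∧
    -- the penalised problems have solutions, which approach the solutions of the relaxed problem
    (∀ t : ℝ, 0 ≤ t → ∃ X, MergerRelaxation.IsPenaltyMinimizer S t X) ∧
    (MergerRelaxation.feasible MergerRelaxation.nuclearNorm S).Nonempty ∧
    (MergerRelaxation.relaxedSolutions S).Nonempty ∧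
    ∃ v : ℝ,
      IsGLB (MergerRelaxation.l1Norm ''
        MergerRelaxation.feasible MergerRelaxation.nuclearNorm S) v ∧
      ∀ (t : ℕ → ℝ) (X : ℕ → Matrix (Fin m) (Fin n) ℝ),
        Tendsto t atTop atTop →
        (∀ k, MergerRelaxation.IsPenaltyMinimizer S (t k) (X k)) →
          (∀ᶠ k in atTop, MergerRelaxation.nuclearNorm S ≤ MergerRelaxation.nuclearNorm (X k)) ∧
          Tendsto (fun k => MergerRelaxation.penalty (X k) S (t k)) atTop (𝓝 v) ∧
          Tendsto (fun k => MergerRelaxation.l1Norm (X k)) atTop (𝓝 v) ∧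
          Tendsto X atTop (𝓝ˢ (MergerRelaxation.relaxedSolutions S)) := by
  open MergerRelaxation in
  have : Nonempty (Fin m) := Fin.pos_iff_nonempty.mp hm
  have : Nonempty (Fin n) := Fin.pos_iff_nonempty.mp hn
  obtain ⟨Z, hZ⟩ := relaxedSolutions_nonempty S
  refine ⟨convexOn_l1Norm, not_convexOn_rankFn, not_convex_feasible_rankFn,
    isConvexEnvelopeOn_nuclearNorm, fun X hX t => penalty_eq_l1Norm hX t,
    fun X hX => tendsto_penalty_atTop hX, fun t ht => exists_isPenaltyMinimizer S ht,
    feasible_nuclearNorm_nonempty S, ⟨Z, hZ⟩, l1Norm Z, hZ.2, fun t X ht hX => ?_⟩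
  have hsol : ∀ᶠ k in atTop, X k ∈ relaxedSolutions S :=
    (ht.eventually_gt_atTop (m * n : ℝ)).mono fun k hk => (hX k).mem_relaxedSolutions hk
  have hfeas : ∀ᶠ k in atTop, nuclearNorm S ≤ nuclearNorm (X k) :=
    hsol.mono fun k hk => (mem_relaxedSolutions_iff.mp hk).1
  have hval : ∀ᶠ k in atTop, l1Norm (X k) = l1Norm Z :=
    hsol.mono fun k hk => hk.2.unique hZ.2
  have hpenalty : ∀ᶠ k in atTop, penalty (X k) S (t k) = l1Norm Z := by
    filter_upwards [hfeas, hval] with k hk hkZ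
    rw [penalty_eq_l1Norm hk, hkZ]
  exact ⟨hfeas, tendsto_nhds_of_eventually_eq hpenalty, tendsto_nhds_of_eventually_eq hval,
    (tendsto_principal.mpr hsol).mono_right principal_le_nhdsSet⟩
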